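/- Let $(M,g)$ be a compact smooth Riemannian $n$-manifold without boundary, with Riemannian volume measure $V_g$, let $k\ge 0$, and let $\mu=\rho\,V_g$ be a finite measure with a measurable density $\rho$ such that $0<\rho\le C$ $V_g$-almost everywhere for some constant $C$. For a Borel measure $\nu$ on $M$ let $L^2(\bigwedge^kM,\nu)$ be the space of $\nu$-measurable $k$-forms $\omega$ with $\int_M|\omega|_g^2\,d\nu<\infty$, with inner product $\langle\omega,\eta\rangle_\nu=\int_M\langle\omega,\eta\rangle_g\,d\nu$. Let $W^{1,2}(\bigwedge^kM)$ be the space of $\omega\in L^2(\bigwedge^kM,V_g)$ whose coefficients have locally integrable weak first derivatives in every smooth chart and for which the exterior derivative $d\omega=\sum_{r,I}\frac{\partial\omega_I}{\partial x^r}dx^r\wedge dx^I$ and the adjoint derivative $d^*\omega$ are in $L^2$; here $d^*\omega=0$ if $k=0$, and otherwise $d^*\omega$ is determined by $\langle d^*\omega,\eta\rangle_{V_g}=\langle\omega,d\eta\rangle_{V_g}$ for all smooth $(k-1)$-forms $\eta$. Give it the inner product $\langle u,v\rangle_{W^{1,2}}=\langle u,v\rangle_{V_g}+\mathcal E(u,v)$,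 where $\mathcal E(u,v)=\int_M\big(\langle du,dv\rangle_g+\langle d^*u,d^*v\rangle_g\big)\,dV_g$, and let $W^{1,2}_0(\bigwedge^kM)$ be the closure in it of the smooth $k$-forms. For $\nu\in\{\mu,V_g\}$ and $u\in W^{1,2}_0(\bigwedge^kM)$ let $\iota_\nu(u)\in L^2(\bigwedge^kM,\nu)$ be the limit in $L^2(\bigwedge^kM,\nu)$ of smooth forms that converge to $u$ in $W^{1,2}$. Let $\mathcal N_{k,\nu}=\{u\in W^{1,2}_0(\bigwedge^kM):\iota_\nu(u)=0\}$, let $\mathcal N_{k,\nu}^\perp$ be its orthogonal complement in $W^{1,2}_0(\bigwedge^kM)$, and let $\operatorname{dom}(\mathcal E_\nu)=\iota_\nu(\mathcal N_{k,\nu}^\perp)$ with $\mathcal E_\nu(\iota_\nu u,\iota_\nu v)=\mathcal E(u,v)$. The operator $\Delta^k_\nu$ on $L^2(\bigwedge^kM,\nu)$ is defined as follows: $w\in\operatorname{dom}(\Delta^k_\nu)$ and $\Delta^k_\nu w=f$ if and only if $w\in\operatorname{dom}(\mathcal E_\nu)$, $f\in L^2(\bigwedge^kM,\nu)$ and $\mathcal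 E_\nu(w,v)=\langle -f,v\rangle_\nu$ for all $v\in\operatorname{dom}(\mathcal E_\nu)$. Put $\Delta^k=\Delta^k_{V_g}$, and $$\mathcal H^k_\mu(M)=\{\omega\in\operatorname{dom}(\Delta^k_\mu):\Delta^k_\mu\omega=0\},\qquad \mathcal H^k(M)=\{\omega\in\operatorname{dom}(\Delta^k):\Delta^k\omega=0\},$$ $$\widetilde{\mathcal H}^k(M)=\{\omega\in W^{1,2}_0({\textstyle\bigwedge}^kM): d\omega=0 \text{ and } d^*\omega=0\}.$$ Then $$\mathcal H^k_\mu(M)=\mathcal H^k(M)=\widetilde{\mathcal H}^k(M),$$ where forms that agree almost everywhere are identified ($\mu$ and $V_g$ have the same null sets). -/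

import Mathlib

open scoped Manifold ContDiff ENNReal Topology
open MeasureTheory Filter Set

noncomputable section

namespace HodgeKF

/-- A (not necessarily continuous) `k`-form on the `n`-manifold `M`: an alternating `k`-linear form on
every tangent space. -/
abbrev DiffForm (n : ℕ) (M : Type*) [TopologicalSpace M]
    [ChartedSpace (EuclideanSpace ℝ (Fin n)) M] (k : ℕ) : Type _ :=
  ∀ x : M, TangentSpace (𝓡 n) x [⋀^Fin k]→L[ℝ] ℝ

/-- A smooth Riemannian metric on `M`. -/
abbrev Metric (n : ℕ) (M : Type*) [TopologicalSpace M]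
    [ChartedSpace (EuclideanSpace ℝ (Fin n)) M] [IsManifold (𝓡 n) ∞ M] : Type _ :=
  Bundle.ContMDiffRiemannianMetric (𝓡 n) ∞ (EuclideanSpace ℝ (Fin n))
    (fun x : M => TangentSpace (𝓡 n) x)

/-- The standard basis of `ℝⁿ`, used as a basis of the tangent space at `x` (which Mathlib identifies
with `ℝⁿ` through the preferred chart at `x`). -/
def tangentBasis (n : ℕ) {M : Type*} [TopologicalSpace M]
    [ChartedSpace (EuclideanSpace ℝ (Fin n)) M] (x : M) (i : Fin n) : TangentSpace (𝓡 n) x :=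
  (EuclideanSpace.single i (1 : ℝ) : EuclideanSpace ℝ (Fin n))

variable {n : ℕ} {M : Type*} [TopologicalSpace M] [ChartedSpace (EuclideanSpace ℝ (Fin n)) M]
  {k : ℕ}

/-- The coordinate expression of a `k`-form in a chart `e`: the pullback of `w` by `e⁻¹`, whose
value at `y` on `(∂_{i₁}, …, ∂_{iₖ})` is the component `w_{i₁…iₖ}(e⁻¹ y)`. It is meaningful on
`e.target` only. -/
def localRep (e : OpenPartialHomeomorph M (EuclideanSpace ℝ (Fin n))) (w : DiffForm n M k)
    (y : EuclideanSpace ℝ (Fin n)) : EuclideanSpace ℝ (Fin n) [⋀^Fin k]→L[ℝ] ℝ :=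
  (w (e.symm y)).compContinuousLinearMap (mfderiv (𝓡 n) (𝓡 n) e.symm y)

/-- Smooth `k`-forms: smooth coefficients in every smooth chart. -/
def IsSmooth (w : DiffForm n M k) : Prop :=
  ∀ e ∈ IsManifold.maximalAtlas (𝓡 n) ∞ M, ContDiffOn ℝ ∞ (localRep e w) e.target

/-- `k`-forms measurable with respect to (the completion of) `μ`: measurable coefficients in every
smooth chart. -/
def IsMeas [MeasurableSpace M] (μ : Measure M) (w : DiffForm n M k) : Prop :=
  ∀ e ∈ IsManifold.maximalAtlas (𝓡 n) ∞ M,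
    AEStronglyMeasurable (fun x => localRep e w (e x)) (μ.restrict e.source)

variable [IsManifold (𝓡 n) ∞ M]

/-- The Gram matrix of the metric at `x` in the standard basis of the tangent space. -/
def gram (g : Metric n M) (x : M) : Matrix (Fin n) (Fin n) ℝ :=
  Matrix.of fun i j => g.inner x (tangentBasis n x i) (tangentBasis n x j)

/-- The pointwise inner product of two `k`-covectors at `x`,
`⟨α, β⟩_g = (1/k!) ∑ g^{i₁j₁} ⋯ g^{iₖjₖ} α_{i₁…iₖ} β_{j₁…jₖ}`, the sum over all multi-indices.
It does not depend on the basis; in a `g`-orthonormal basis it is the sum of `α_I β_I` over the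
strictly increasing `I`, so that the `e^{i₁} ∧ ⋯ ∧ e^{iₖ}` are orthonormal. -/
def formInner (g : Metric n M) (x : M) (α β : TangentSpace (𝓡 n) x [⋀^Fin k]→L[ℝ] ℝ) : ℝ :=
  (k.factorial : ℝ)⁻¹ * ∑ I : Fin k → Fin n, ∑ J : Fin k → Fin n,
    (∏ a, (gram g x)⁻¹ (I a) (J a)) * α (fun a => tangentBasis n x (I a)) *
      β (fun a => tangentBasis n x (J a))

/-- The matrix `(g_{ij})` of the metric in the chart `e`, at the point with coordinates `y`. -/
def chartGram (g : Metric n M) (e : OpenPartialHomeomorph M (EuclideanSpace ℝ (Fin n)))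
    (y : EuclideanSpace ℝ (Fin n)) : Matrix (Fin n) (Fin n) ℝ :=
  Matrix.of fun i j => g.inner (e.symm y)
    (mfderiv (𝓡 n) (𝓡 n) e.symm y (EuclideanSpace.single i (1 : ℝ) : EuclideanSpace ℝ (Fin n)))
    (mfderiv (𝓡 n) (𝓡 n) e.symm y (EuclideanSpace.single j (1 : ℝ) : EuclideanSpace ℝ (Fin n)))

/-- The measure `√(det g_{ij}) dx¹ ⋯ dxⁿ` of the chart `e`, as a measure on `M` carried by
`e.source`. -/
def chartVolume [MeasurableSpace M] (g : Metric n M)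
    (e : OpenPartialHomeomorph M (EuclideanSpace ℝ (Fin n))) : Measure M :=
  ((volume.restrict e.target).withDensity
    fun y => ENNReal.ofReal (Real.sqrt (chartGram g e y).det)).map e.symm

/-- The Riemannian volume measure `V_g`: the least measure that dominates the measure
`√(det g_{ij}) dx¹ ⋯ dxⁿ` of every smooth chart. Since these agree on overlaps, and countably many
charts cover `M`, it is the measure which has this expression in every smooth chart. -/
def vol [MeasurableSpace M] (g : Metric n M) : Measure M :=
  ⨆ e ∈ IsManifold.maximalAtlas (𝓡 n) ∞ M, chartVolume g e

/-- `∫ |w|² dμ`, as an extended nonnegative number. -/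
def normSq [MeasurableSpace M] (g : Metric n M) (μ : Measure M) (w : DiffForm n M k) : ℝ≥0∞ :=
  ∫⁻ x, ENNReal.ofReal (formInner g x (w x) (w x)) ∂μ

/-- `⟨w, η⟩_μ = ∫ ⟨w, η⟩_g dμ`. -/
def l2Inner [MeasurableSpace M] (g : Metric n M) (μ : Measure M) (w η : DiffForm n M k) : ℝ :=
  ∫ x, formInner g x (w x) (η x) ∂μ

/-- `w ∈ L²(⋀ᵏM, μ)`. -/
def MemL2 [MeasurableSpace M] (g : Metric n M) (μ : Measure M) (w : DiffForm n M k) : Prop :=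
  IsMeas μ w ∧ normSq g μ w < ⊤

/-- `D` is the generalized gradient of `f` on the open set `U ⊆ ℝⁿ`: both are locally integrable
on `U`, and `∫ ∂_v φ f = - ∫ φ D_v` for all test functions `φ` and all directions `v`. -/
def HasWeakGradOn {F : Type*} [NormedAddCommGroup F] [NormedSpace ℝ F]
    (U : Set (EuclideanSpace ℝ (Fin n))) (f : EuclideanSpace ℝ (Fin n) → F)
    (D : EuclideanSpace ℝ (Fin n) → EuclideanSpace ℝ (Fin n) →L[ℝ] F) : Prop :=
  LocallyIntegrableOn f U ∧ LocallyIntegrableOn D U ∧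
    ∀ φ : EuclideanSpace ℝ (Fin n) → ℝ, ContDiff ℝ ∞ φ → HasCompactSupport φ → tsupport φ ⊆ U →
      ∀ v, ∫ y, (fderiv ℝ φ y v) • f y = - ∫ y, φ y • D y v

/-- `η` is the exterior derivative of `w`, and lies in `L²`: in every chart the coefficients of
`w` have generalized gradients, and `η = ∑ ∂w_I/∂x^r dx^r ∧ dx^I` almost everywhere. -/
def IsExtD [MeasurableSpace M] (g : Metric n M) (w : DiffForm n M k)
    (η : DiffForm n M (k + 1)) : Prop :=
  MemL2 g (vol g) η ∧ ∀ e ∈ IsManifold.maximalAtlas (𝓡 n) ∞ M,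
    ∃ D, HasWeakGradOn e.target (localRep e w) D ∧
      ∀ᵐ y ∂(volume.restrict e.target),
        localRep e η y = ContinuousAlternatingMap.alternatizeUncurryFin (D y)

open Classical in
/-- The exterior derivative `dw` (unique up to null sets; `0` if there is none in `L²`). -/
def extD [MeasurableSpace M] (g : Metric n M) (w : DiffForm n M k) : DiffForm n M (k + 1) :=
  if h : ∃ η, IsExtD g w η then h.choose else 0

/-- `θ` is the adjoint derivative `d*w`, and lies in `L²`: `⟨θ, η⟩ = ⟨w, dη⟩` for all smooth
`η`. On `0`-forms `d*` is zero (the degree `0 - 1 = 0` of `d*w` is then a dummy). -/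
def IsCodiff [MeasurableSpace M] (g : Metric n M) :
    {k : ℕ} → DiffForm n M k → DiffForm n M (k - 1) → Prop
  | 0, _, θ => θ = 0
  | k + 1, w, θ => MemL2 g (vol g) (k := k) θ ∧ ∀ η : DiffForm n M k, IsSmooth η →
      l2Inner g (vol g) (k := k) θ η = l2Inner g (vol g) w (extD g η)

open Classical in
/-- The adjoint derivative `d*w` (unique up to null sets; `0` if there is none in `L²`). -/
def codiff [MeasurableSpace M] (g : Metric n M) (w : DiffForm n M k) : DiffForm n M (k - 1) :=
  if h : ∃ θ, IsCodiff g w θ then h.choose else 0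

/-- `w ∈ W^{1,2}(⋀ᵏM)`: `w` is in `L²`, has generalized gradients in all charts, and `dw` and `d*w`
are in `L²`. -/
def MemW12 [MeasurableSpace M] (g : Metric n M) (w : DiffForm n M k) : Prop :=
  MemL2 g (vol g) w ∧ (∃ η, IsExtD g w η) ∧ ∃ θ, IsCodiff g w θ

/-- `‖w‖²_{W^{1,2}} = ∫ |w|² + ∫ |dw|² + ∫ |d*w|²`. -/
def w12NormSq [MeasurableSpace M] (g : Metric n M) (w : DiffForm n M k) : ℝ≥0∞ :=
  normSq g (vol g) w + normSq g (vol g) (extD g w) + normSq g (vol g) (codiff g w)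

/-- `∫ ⟨du, dv⟩_g + ⟨d*u, d*v⟩_g dV_g`. -/
def energy [MeasurableSpace M] (g : Metric n M) (u v : DiffForm n M k) : ℝ :=
  l2Inner g (vol g) (extD g u) (extD g v) + l2Inner g (vol g) (codiff g u) (codiff g v)

/-- The inner product of `W^{1,2}(⋀ᵏM)`. -/
def w12Inner [MeasurableSpace M] (g : Metric n M) (u v : DiffForm n M k) : ℝ :=
  l2Inner g (vol g) u v + energy g u v

/-- The smooth forms `s m` converge to `u` in the norm of `W^{1,2}(⋀ᵏM)`. -/
def SmoothApprox [MeasurableSpace M] (g : Metric n M) (u : DiffForm n M k)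
    (s : ℕ → DiffForm n M k) : Prop :=
  (∀ m, IsSmooth (s m)) ∧ Tendsto (fun m => w12NormSq g (u - s m)) atTop (𝓝 0)

/-- `W₀^{1,2}(⋀ᵏM)`, the closure of the smooth (compactly supported, as `M` is compact) forms in
`W^{1,2}(⋀ᵏM)`. -/
def W120 [MeasurableSpace M] (g : Metric n M) (k : ℕ) : Set (DiffForm n M k) :=
  {u | MemW12 g u ∧ ∃ s, SmoothApprox g u s}

/-- `w = ι(u)` in `L²(⋀ᵏM, μ)`: smooth forms converging to `u` in `W^{1,2}` converge to `w` in
`L²(⋀ᵏM, μ)`. -/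
def IsRep [MeasurableSpace M] (g : Metric n M) (μ : Measure M) (u w : DiffForm n M k) : Prop :=
  MemL2 g μ w ∧ ∃ s, SmoothApprox g u s ∧ Tendsto (fun m => normSq g μ (w - s m)) atTop (𝓝 0)

/-- `𝒩ₖ = {u ∈ W₀^{1,2} : ‖ι(u)‖_μ = 0}`. -/
def nullSpace [MeasurableSpace M] (g : Metric n M) (μ : Measure M) (k : ℕ) :
    Set (DiffForm n M k) :=
  {u | u ∈ W120 g k ∧ ∃ w, IsRep g μ u w ∧ normSq g μ w = 0}

/-- The orthogonal complement of `𝒩ₖ` in `W₀^{1,2}(⋀ᵏM)`. -/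
def nullPerp [MeasurableSpace M] (g : Metric n M) (μ : Measure M) (k : ℕ) :
    Set (DiffForm n M k) :=
  {u | u ∈ W120 g k ∧ ∀ v ∈ nullSpace g μ k, w12Inner g u v = 0}

/-- `w ∈ dom(Δᵏ_μ)` and `Δᵏ_μ w = f`, that is, `w` lies in `dom(𝓔) = ι(𝒩ₖ^⊥)`, `f` lies in
`L²(⋀ᵏM, μ)`, and `𝓔(w, v) = ⟨-f, v⟩_μ` for all `v ∈ dom(𝓔)`. Here
`𝓔(ι(u), ι(v)) = ∫ ⟨du, dv⟩_g + ⟨d*u, d*v⟩_g dV_g` for `u, v ∈ 𝒩ₖ^⊥`.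
This is the graph of the operator: `f` is unique up to `μ`-null sets as `dom(𝓔)` is dense. -/
def IsKreinFeller [MeasurableSpace M] (g : Metric n M) (μ : Measure M)
    (w f : DiffForm n M k) : Prop :=
  MemL2 g μ f ∧ ∃ u ∈ nullPerp g μ k, IsRep g μ u w ∧
    ∀ v ∈ nullPerp g μ k, ∀ v', IsRep g μ v v' → energy g u v = l2Inner g μ (-f) v'

/-- The `μ`-harmonic `k`-forms: `w ∈ dom(Δᵏ_μ)` with `Δᵏ_μ w = 0`. -/
def muHarmonicForms [MeasurableSpace M] (g : Metric n M) (μ : Measure M) (k : ℕ) :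
    Set (DiffForm n M k) :=
  {w | IsKreinFeller g μ w 0}

/-- The harmonic `k`-forms: `w ∈ dom(Δᵏ)` with `Δᵏ w = 0`, where `Δᵏ = Δᵏ_μ` for `μ = V_g`. -/
def harmonicForms [MeasurableSpace M] (g : Metric n M) (k : ℕ) : Set (DiffForm n M k) :=
  muHarmonicForms g (vol g) k

/-- The harmonic `k`-fields: `w ∈ W₀^{1,2}(⋀ᵏM)` with `dw = d*w = 0` (almost everywhere). -/
def harmonicFields [MeasurableSpace M] (g : Metric n M) (k : ℕ) : Set (DiffForm n M k) :=
  {w | w ∈ W120 g k ∧ (∀ᵐ x ∂(vol g), extD g w x = 0) ∧ ∀ᵐ x ∂(vol g), codiff g w x = 0}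

end HodgeKF

end

noncomputable section

namespace HodgeKF

/-! Because the density is bounded, convergence in $W^{1,2}$ forces convergence in $L^2(\mu)$.
Limits there are unique up to null sets, and $\mu$ and $V_g$ have the same null sets, so
$\iota_\mu(u)=u$ almost everywhere (`IsRep.ae_eq`). Hence $\mathcal N_{k,\mu}$ contains only null
forms, its orthogonal complement is all of $W^{1,2}_0$, and $\mathcal E_\mu$ is the energy $\mathcal
E$ on an unchanged domain.

If $\Delta^k_\mu w=0$, testing with $w$ itself gives $\|dw\|^2+\|d^*w\|^2=0$. Conversely $dw=d^*w=0$
makes $\mathcal E(w,\cdot)$ vanish identically. This is `muHarmonicForms_eq_harmonicFields`; the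
theorem applies it to $\mu$ and to $V_g$. No elliptic regularity enters.

The supporting work shows that the pointwise product of forms is positive definite and measurable,
and that `extD`, `codiff` and `W120` depend only on almost-everywhere classes. -/

/-- The `k`-fold Kronecker power of a square matrix. -/
def kroneckerPow {n : ℕ} (k : ℕ) (A : Matrix (Fin n) (Fin n) ℝ) :
    Matrix (Fin k → Fin n) (Fin k → Fin n) ℝ :=
  Matrix.of fun I J => ∏ a, A (I a) (J a)

/-! ### Linear algebra: the inner product that a Gram matrix induces on alternating forms. -/

section LinearAlgebra

open Matrix

variable {n k : ℕ}

/-- A product of sums expands into a sum over multi-indices. Multiplicativity carries congruences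
and factorizations of Gram matrices over to degree `k`. -/
lemma kroneckerPow_mul (A B : Matrix (Fin n) (Fin n) ℝ) :
    kroneckerPow k (A * B) = kroneckerPow k A * kroneckerPow k B := by
  ext I J
  simp only [kroneckerPow, Matrix.of_apply, Matrix.mul_apply, ← Finset.prod_mul_distrib]
  rw [Finset.prod_univ_sum, Fintype.piFinset_univ]

lemma kroneckerPow_one : kroneckerPow k (1 : Matrix (Fin n) (Fin n) ℝ) = 1 := by
  ext I J
  simp only [kroneckerPow, Matrix.of_apply, Matrix.one_apply]
  rw [Finset.prod_ite_zero]
  simp [funext_iff]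

lemma kroneckerPow_transpose (A : Matrix (Fin n) (Fin n) ℝ) :
    kroneckerPow k Aᵀ = (kroneckerPow k A)ᵀ := rfl

variable {V : Type*} [AddCommGroup V] [Module ℝ V]

/-- The Gram matrix of a family of vectors. -/
def gramMatrix (B : V →ₗ[ℝ] V →ₗ[ℝ] ℝ) (b : Fin n → V) : Matrix (Fin n) (Fin n) ℝ :=
  Matrix.of fun i j => B (b i) (b j)

lemma gramMatrix_sum_smul (B : V →ₗ[ℝ] V →ₗ[ℝ] ℝ) (b : Fin n → V)
    (P : Matrix (Fin n) (Fin n) ℝ) :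
    gramMatrix B (fun i => ∑ j, P i j • b j) = P * gramMatrix B b * Pᵀ := by
  ext i j
  simp only [gramMatrix, Matrix.of_apply, Matrix.mul_apply, Matrix.transpose_apply, map_sum,
    LinearMap.sum_apply, map_smul, LinearMap.smul_apply, smul_eq_mul, Finset.sum_mul]
  refine Finset.sum_congr rfl fun x _ => ?_
  rw [Finset.mul_sum]
  refine Finset.sum_congr rfl fun y _ => ?_
  ring

lemma basis_eq_sum_smul (b b' : Module.Basis (Fin n) ℝ V) :
    (b' : Fin n → V) = fun i => ∑ j, (b.toMatrix b')ᵀ i j • b j := by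
  funext i
  simp only [Matrix.transpose_apply]
  exact (b.sum_toMatrix_smul_self b' i).symm

lemma gramMatrix_posDef (B : V →ₗ[ℝ] V →ₗ[ℝ] ℝ) (hs : ∀ v w, B v w = B w v)
    (hp : ∀ v, v ≠ 0 → 0 < B v v) (b : Module.Basis (Fin n) ℝ V) : (gramMatrix B b).PosDef := by
  refine Matrix.PosDef.of_dotProduct_mulVec_pos ?_ fun x hx => ?_
  · ext i j
    simp [gramMatrix, hs]
  · have h : star x ⬝ᵥ gramMatrix B b *ᵥ x = B (∑ i, x i • b i) (∑ i, x i • b i) := by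
      simp only [dotProduct, mulVec, gramMatrix, Matrix.of_apply, map_sum, LinearMap.sum_apply,
        map_smul, LinearMap.smul_apply, smul_eq_mul, Finset.mul_sum, star_trivial]
      rw [Finset.sum_comm]
      refine Finset.sum_congr rfl fun i _ => Finset.sum_congr rfl fun j _ => ?_
      ring
    rw [h]
    refine hp _ fun h0 => hx ?_
    funext i
    exact Fintype.linearIndependent_iff.1 b.linearIndependent x h0 i

variable [TopologicalSpace V]

/-- The components of an alternating form with respect to a family of vectors. -/
def components (b : Fin n → V) (α : V [⋀^Fin k]→L[ℝ] ℝ) (I : Fin k → Fin n) : ℝ :=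
  α fun a => b (I a)

/-- The inner product of two alternating forms computed from the Gram matrix `G` of the
vectors `b`. -/
def gramPairing (G : Matrix (Fin n) (Fin n) ℝ) (b : Fin n → V) (α β : V [⋀^Fin k]→L[ℝ] ℝ) : ℝ :=
  (k.factorial : ℝ)⁻¹ * (components b α ⬝ᵥ kroneckerPow k G⁻¹ *ᵥ components b β)

lemma gramPairing_eq_sum (G : Matrix (Fin n) (Fin n) ℝ) (b : Fin n → V)
    (α β : V [⋀^Fin k]→L[ℝ] ℝ) :
    gramPairing G b α β = (k.factorial : ℝ)⁻¹ * ∑ I : Fin k → Fin n, ∑ J : Fin k → Fin n,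
      (∏ a, G⁻¹ (I a) (J a)) * α (fun a => b (I a)) * β (fun a => b (J a)) := by
  simp only [gramPairing, dotProduct, mulVec, components, kroneckerPow, Matrix.of_apply,
    Finset.mul_sum]
  refine Finset.sum_congr rfl fun I _ => Finset.sum_congr rfl fun J _ => ?_
  ring

lemma components_sum_smul (b : Fin n → V) (P : Matrix (Fin n) (Fin n) ℝ)
    (α : V [⋀^Fin k]→L[ℝ] ℝ) :
    components (fun i => ∑ j, P i j • b j) α = kroneckerPow k P *ᵥ components b α := by
  ext I
  simp only [components, mulVec, dotProduct, kroneckerPow, Matrix.of_apply]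
  have h := (α.toMultilinearMap).map_sum (fun (a : Fin k) (j : Fin n) => P (I a) j • b j)
  refine h.trans (Finset.sum_congr rfl fun K _ => ?_)
  exact (α.toMultilinearMap).map_smul_univ (fun a => P (I a) (K a)) (fun a => b (K a))

/-- A change of basis `P` turns the Gram matrix `G` into `P * G * Pᵀ` and multiplies components by
the Kronecker power of `P`; these factors cancel against the inverse of the new Gram matrix. -/
lemma gramPairing_basis_eq (B : V →ₗ[ℝ] V →ₗ[ℝ] ℝ) (b b' : Module.Basis (Fin n) ℝ V)
    (α β : V [⋀^Fin k]→L[ℝ] ℝ) :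
    gramPairing (gramMatrix B b') b' α β = gramPairing (gramMatrix B b) b α β := by
  have hPu : IsUnit (b.toMatrix b')ᵀ.det := by
    rw [det_transpose]
    exact (Matrix.isUnit_iff_isUnit_det _).1 ⟨⟨_, _, b.toMatrix_mul_toMatrix_flip b',
      b'.toMatrix_mul_toMatrix_flip b⟩, rfl⟩
  rw [basis_eq_sum_smul b b', gramMatrix_sum_smul]
  generalize (b.toMatrix b')ᵀ = P at hPu
  have hPu' : IsUnit Pᵀ.det := by rwa [det_transpose]
  have key : Pᵀ * (P * gramMatrix B b * Pᵀ)⁻¹ * P = (gramMatrix B b)⁻¹ := by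
    rw [Matrix.mul_inv_rev, Matrix.mul_inv_rev, Matrix.mul_assoc, Matrix.mul_assoc,
      Matrix.mul_assoc, Matrix.nonsing_inv_mul _ hPu, Matrix.mul_one, ← Matrix.mul_assoc,
      Matrix.mul_nonsing_inv _ hPu', Matrix.one_mul]
  simp only [gramPairing, components_sum_smul]
  rw [← key, kroneckerPow_mul, kroneckerPow_mul, kroneckerPow_transpose,
    ← Matrix.mulVec_mulVec, ← Matrix.mulVec_mulVec,
    Matrix.dotProduct_mulVec (components (⇑b) α) (kroneckerPow k P)ᵀ, Matrix.vecMul_transpose]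

open scoped MatrixOrder Matrix.Norms.L2Operator in
/-- The inner product of forms is a sum of squares of linear functionals which separate points. -/
lemma exists_gramPairing_eq_sum (G : Matrix (Fin n) (Fin n) ℝ) (hG : G.PosDef)
    (b : Module.Basis (Fin n) ℝ V) :
    ∃ L : (V [⋀^Fin k]→L[ℝ] ℝ) → (Fin k → Fin n) → ℝ, (∀ α β, L (α - β) = L α - L β) ∧
      (∀ α, L α = 0 → α = 0) ∧
      ∀ α β, gramPairing G b α β = (k.factorial : ℝ)⁻¹ * ∑ I, L α I * L β I := by
  -- With `G⁻¹ = Aᵀ * A`, the functionals are the entries of the Kronecker power of `A` applied to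
  -- the components; they separate points because `A` is invertible.
  obtain ⟨A, hA⟩ := CStarAlgebra.nonneg_iff_eq_star_mul_self.mp hG.inv.posSemidef.nonneg
  rw [Matrix.star_eq_conjTranspose, Matrix.conjTranspose_eq_transpose_of_trivial] at hA
  have hAu : IsUnit A.det := by
    have h := (Matrix.isUnit_iff_isUnit_det _).1 hG.inv.isUnit
    rw [hA, Matrix.det_mul] at h
    exact isUnit_of_mul_isUnit_right h
  refine ⟨fun α => kroneckerPow k A *ᵥ components b α, fun α β => ?_, fun α h => ?_,
    fun α β => ?_⟩
  · rw [← Matrix.mulVec_sub]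
    rfl
  · have h0 : components b α = 0 := by
      have := congrArg (fun v => kroneckerPow k A⁻¹ *ᵥ v) h
      simpa [← kroneckerPow_mul, Matrix.nonsing_inv_mul _ hAu, kroneckerPow_one] using this
    apply ContinuousAlternatingMap.toAlternatingMap_injective
    apply AlternatingMap.coe_multilinearMap_injective
    refine Module.Basis.ext_multilinear (fun _ => b) fun I => ?_
    exact congrFun h0 I
  · rw [gramPairing, hA, kroneckerPow_mul, kroneckerPow_transpose, ← Matrix.mulVec_mulVec,
      Matrix.dotProduct_mulVec, Matrix.vecMul_transpose]
    rfl

end LinearAlgebra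

/-! ### The pointwise inner product on the manifold and its expression in charts. -/

section Charts

variable {n k : ℕ} {M : Type*} [TopologicalSpace M] [ChartedSpace (EuclideanSpace ℝ (Fin n)) M]

/-- The standard basis of the tangent space. -/
def tangentStdBasis (n : ℕ) {M : Type*} [TopologicalSpace M]
    [ChartedSpace (EuclideanSpace ℝ (Fin n)) M] (x : M) :
    Module.Basis (Fin n) ℝ (TangentSpace (𝓡 n) x) :=
  (EuclideanSpace.basisFun (Fin n) ℝ).toBasis

lemma coe_tangentStdBasis (x : M) : ⇑(tangentStdBasis n x) = tangentBasis n x := by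
  funext i
  exact congrFun (EuclideanSpace.basisFun (Fin n) ℝ).coe_toBasis i |>.trans
    (EuclideanSpace.basisFun_apply _ _ i)

lemma mdifferentiable_of_mem_maximalAtlas
    {e : OpenPartialHomeomorph M (EuclideanSpace ℝ (Fin n))}
    (he : e ∈ IsManifold.maximalAtlas (𝓡 n) ∞ M) : e.MDifferentiable (𝓡 n) (𝓡 n) :=
  ⟨(contMDiffOn_of_mem_maximalAtlas he).mdifferentiableOn (by simp),
    (contMDiffOn_symm_of_mem_maximalAtlas he).mdifferentiableOn (by simp)⟩

/-- The coordinate basis of a chart. -/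
def chartBasis {e : OpenPartialHomeomorph M (EuclideanSpace ℝ (Fin n))}
    (he : e ∈ IsManifold.maximalAtlas (𝓡 n) ∞ M) {y : EuclideanSpace ℝ (Fin n)}
    (hy : y ∈ e.target) : Module.Basis (Fin n) ℝ (TangentSpace (𝓡 n) (e.symm y)) :=
  (tangentStdBasis n y).map
    ((mdifferentiable_of_mem_maximalAtlas he).symm.mfderiv (x := y) hy).toLinearEquiv

lemma chartBasis_apply {e : OpenPartialHomeomorph M (EuclideanSpace ℝ (Fin n))}
    (he : e ∈ IsManifold.maximalAtlas (𝓡 n) ∞ M) {y : EuclideanSpace ℝ (Fin n)}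
    (hy : y ∈ e.target) (i : Fin n) : chartBasis he hy i =
      mfderiv (𝓡 n) (𝓡 n) e.symm y (EuclideanSpace.single i (1 : ℝ) : EuclideanSpace ℝ (Fin n)) := by
  rw [chartBasis, Module.Basis.map_apply, coe_tangentStdBasis]
  rfl

variable [IsManifold (𝓡 n) ∞ M]

/-- The metric at a point as a bilinear form. -/
def metricBilin (g : Metric n M) (x : M) :
    TangentSpace (𝓡 n) x →ₗ[ℝ] TangentSpace (𝓡 n) x →ₗ[ℝ] ℝ :=
  LinearMap.mk₂ ℝ (fun v w => g.inner x v w) (by simp) (by simp) (by simp) (by simp)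

lemma formInner_eq_gramPairing (g : Metric n M) (x : M)
    (α β : TangentSpace (𝓡 n) x [⋀^Fin k]→L[ℝ] ℝ) :
    formInner g x α β =
      gramPairing (gramMatrix (metricBilin g x) (tangentStdBasis n x)) (tangentStdBasis n x) α β := by
  rw [gramPairing_eq_sum, coe_tangentStdBasis]
  rfl

lemma gramMatrix_chartBasis (g : Metric n M)
    {e : OpenPartialHomeomorph M (EuclideanSpace ℝ (Fin n))}
    (he : e ∈ IsManifold.maximalAtlas (𝓡 n) ∞ M) {y : EuclideanSpace ℝ (Fin n)}
    (hy : y ∈ e.target) :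
    gramMatrix (metricBilin g (e.symm y)) (chartBasis he hy) = chartGram g e y := by
  ext i j
  simp only [gramMatrix, chartGram, Matrix.of_apply, chartBasis_apply]
  rfl

lemma metricBilin_symm (g : Metric n M) (x : M) (v w : TangentSpace (𝓡 n) x) :
    metricBilin g x v w = metricBilin g x w v := g.symm x v w

lemma metricBilin_pos (g : Metric n M) (x : M) (v : TangentSpace (𝓡 n) x) (hv : v ≠ 0) :
    0 < metricBilin g x v v := g.pos x v hv

lemma chartGram_det_pos (g : Metric n M)
    {e : OpenPartialHomeomorph M (EuclideanSpace ℝ (Fin n))}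
    (he : e ∈ IsManifold.maximalAtlas (𝓡 n) ∞ M) {y : EuclideanSpace ℝ (Fin n)}
    (hy : y ∈ e.target) : 0 < (chartGram g e y).det := by
  rw [← gramMatrix_chartBasis g he hy]
  exact (gramMatrix_posDef _ (metricBilin_symm g _) (metricBilin_pos g _) _).det_pos

/-- The pointwise inner product of two forms in terms of their coordinate expressions. -/
lemma formInner_eq_chart (g : Metric n M)
    {e : OpenPartialHomeomorph M (EuclideanSpace ℝ (Fin n))}
    (he : e ∈ IsManifold.maximalAtlas (𝓡 n) ∞ M) (w η : DiffForm n M k)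
    {y : EuclideanSpace ℝ (Fin n)} (hy : y ∈ e.target) :
    formInner g (e.symm y) (w (e.symm y)) (η (e.symm y)) =
      (k.factorial : ℝ)⁻¹ * ∑ I : Fin k → Fin n, ∑ J : Fin k → Fin n,
        (∏ a, (chartGram g e y)⁻¹ (I a) (J a)) *
          localRep e w y (fun a => EuclideanSpace.single (I a) 1) *
          localRep e η y (fun a => EuclideanSpace.single (J a) 1) := by
  rw [formInner_eq_gramPairing, ← gramPairing_basis_eq _ _ (chartBasis he hy),
    gramMatrix_chartBasis, gramPairing_eq_sum]
  simp only [chartBasis_apply]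
  rfl

/-- Positivity, definiteness and the quadratic inequality below thereby become statements about real
numbers. The functionals are chosen point by point, with no regularity in `x`. -/
lemma exists_formInner_eq_sum (g : Metric n M) (k : ℕ) (x : M) :
    ∃ L : (TangentSpace (𝓡 n) x [⋀^Fin k]→L[ℝ] ℝ) → (Fin k → Fin n) → ℝ,
      (∀ α β, L (α - β) = L α - L β) ∧ (∀ α, L α = 0 → α = 0) ∧
      ∀ α β, formInner g x α β = (k.factorial : ℝ)⁻¹ * ∑ I, L α I * L β I := by
  simp only [formInner_eq_gramPairing]
  exact exists_gramPairing_eq_sum _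
    (gramMatrix_posDef _ (metricBilin_symm g _) (metricBilin_pos g _) _) _

lemma formInner_self_nonneg (g : Metric n M) (x : M)
    (α : TangentSpace (𝓡 n) x [⋀^Fin k]→L[ℝ] ℝ) : 0 ≤ formInner g x α α := by
  obtain ⟨L, -, -, h⟩ := exists_formInner_eq_sum g k x
  rw [h]
  exact mul_nonneg (by positivity) (Finset.sum_nonneg fun I _ => mul_self_nonneg _)

lemma eq_zero_of_formInner_self (g : Metric n M) (x : M)
    (α : TangentSpace (𝓡 n) x [⋀^Fin k]→L[ℝ] ℝ) (h0 : formInner g x α α = 0) : α = 0 := by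
  obtain ⟨L, -, h', h⟩ := exists_formInner_eq_sum g k x
  rw [h, mul_eq_zero, or_iff_right (by positivity),
    Finset.sum_eq_zero_iff_of_nonneg fun I _ => mul_self_nonneg _] at h0
  exact h' α (funext fun I => mul_self_eq_zero.1 (h0 I (Finset.mem_univ _)))

lemma formInner_zero_left (g : Metric n M) (x : M)
    (β : TangentSpace (𝓡 n) x [⋀^Fin k]→L[ℝ] ℝ) : formInner g x 0 β = 0 := by
  simp [formInner]

lemma formInner_zero_right (g : Metric n M) (x : M)
    (α : TangentSpace (𝓡 n) x [⋀^Fin k]→L[ℝ] ℝ) : formInner g x α 0 = 0 := by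
  simp [formInner]

/-- A triangle inequality for squared norms, free of square roots, which can be integrated as it
stands. -/
lemma formInner_sub_self_le (g : Metric n M) (x : M)
    (α β γ : TangentSpace (𝓡 n) x [⋀^Fin k]→L[ℝ] ℝ) :
    formInner g x (α - β) (α - β) ≤
      2 * formInner g x (α - γ) (α - γ) + 2 * formInner g x (β - γ) (β - γ) := by
  obtain ⟨L, hL, -, h⟩ := exists_formInner_eq_sum g k x
  have h2 : ∑ I, L (α - β) I * L (α - β) I ≤
      2 * ∑ I, L (α - γ) I * L (α - γ) I + 2 * ∑ I, L (β - γ) I * L (β - γ) I := by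
    rw [Finset.mul_sum, Finset.mul_sum, ← Finset.sum_add_distrib]
    refine Finset.sum_le_sum fun I _ => ?_
    simp only [hL, Pi.sub_apply]
    -- With `p = α - γ` and `q = β - γ`, the defect `2p² + 2q² - (p - q)²` equals `(p + q)²`.
    nlinarith [sq_nonneg (L α I + L β I - 2 * L γ I)]
  simp only [h]
  have hk : (0 : ℝ) ≤ (k.factorial : ℝ)⁻¹ := by positivity
  nlinarith [mul_le_mul_of_nonneg_left h2 hk]

lemma continuousOn_chartGram_apply (g : Metric n M)
    {e : OpenPartialHomeomorph M (EuclideanSpace ℝ (Fin n))}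
    (he : e ∈ IsManifold.maximalAtlas (𝓡 n) ∞ M) (i j : Fin n) :
    ContinuousOn (fun y => chartGram g e y i j) e.target := by
  have : IsManifold (𝓡 n) 1 M := IsManifold.of_le (n := ∞) (by simp)
  have hsymm := contMDiffOn_symm_of_mem_maximalAtlas he
  have hvec : ∀ v : EuclideanSpace ℝ (Fin n), ContMDiffOn (𝓡 n) ((𝓡 n).prod (𝓡 n)) 0
      (fun y => Bundle.TotalSpace.mk' (EuclideanSpace ℝ (Fin n))
        (E := fun x : M => TangentSpace (𝓡 n) x) (e.symm y)
        (mfderiv (𝓡 n) (𝓡 n) e.symm y v)) e.target := by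
    intro v
    -- A coordinate field is the tangent map of `e.symm` composed with the constant section `y ↦ (y,
    -- v)`.
    have h1 := hsymm.contMDiffOn_tangentMapWithin (m := 0) (by simp)
      e.open_target.uniqueMDiffOn
    have h2 : ContMDiffOn (𝓡 n) ((𝓡 n).prod (𝓡 n)) 0
        (fun y : EuclideanSpace ℝ (Fin n) => (⟨y, v⟩ : TangentBundle (𝓡 n) _)) e.target :=
      contMDiffOn_vectorSpace_iff_contDiffOn.2 contDiffOn_const
    refine (h1.comp h2 fun y hy => hy).congr fun y hy => ?_
    simp only [Function.comp, tangentMapWithin, mfderivWithin_of_isOpen e.open_target hy]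
  have hg : ContMDiffOn (𝓡 n) ((𝓡 n).prod 𝓘(ℝ, EuclideanSpace ℝ (Fin n) →L[ℝ]
      EuclideanSpace ℝ (Fin n) →L[ℝ] ℝ)) 0 (fun y => Bundle.TotalSpace.mk'
        (EuclideanSpace ℝ (Fin n) →L[ℝ] EuclideanSpace ℝ (Fin n) →L[ℝ] ℝ)
        (E := fun x : M => TangentSpace (𝓡 n) x →L[ℝ] TangentSpace (𝓡 n) x →L[ℝ] ℝ)
        (e.symm y) (g.inner (e.symm y))) e.target :=
    (g.contMDiff.comp_contMDiffOn hsymm).of_le (by simp)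
  have h := hg.clm_bundle_apply₂ (F₁ := EuclideanSpace ℝ (Fin n))
    (F₂ := EuclideanSpace ℝ (Fin n)) (F₃ := ℝ) (E₃ := Bundle.Trivial M ℝ)
    (hvec (EuclideanSpace.single i 1)) (hvec (EuclideanSpace.single j 1))
  intro y hy
  exact ((Bundle.contMDiffWithinAt_totalSpace.1 (h y hy)).2).continuousWithinAt

end Charts

/-! ### Measurability, null sets and limits in $L^2$. -/

section Measure

variable {n k : ℕ} {M : Type*} [TopologicalSpace M] [ChartedSpace (EuclideanSpace ℝ (Fin n)) M]

lemma localRep_congr {e : OpenPartialHomeomorph M (EuclideanSpace ℝ (Fin n))}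
    {w η : DiffForm n M k} {y : EuclideanSpace ℝ (Fin n)} (h : w (e.symm y) = η (e.symm y)) :
    localRep e w y = localRep e η y := by
  simp only [localRep, h]

lemma localRep_sub (e : OpenPartialHomeomorph M (EuclideanSpace ℝ (Fin n)))
    (w η : DiffForm n M k) (y : EuclideanSpace ℝ (Fin n)) :
    localRep e (w - η) y = localRep e w y - localRep e η y := by
  rfl

lemma localRep_zero (e : OpenPartialHomeomorph M (EuclideanSpace ℝ (Fin n)))
    (y : EuclideanSpace ℝ (Fin n)) : localRep e (0 : DiffForm n M k) y = 0 := by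
  rfl

variable [MeasurableSpace M] {μ ν : Measure M} {w η : DiffForm n M k}

lemma isMeas_zero : IsMeas μ (0 : DiffForm n M k) := by
  intro e _
  simp only [localRep_zero]
  exact aestronglyMeasurable_const

lemma IsMeas.sub (hw : IsMeas μ w) (hη : IsMeas μ η) : IsMeas μ (w - η) := by
  intro e he
  simp only [localRep_sub]
  exact (hw e he).sub (hη e he)

lemma IsMeas.mono_ac (hw : IsMeas μ w) (h : ν ≪ μ) : IsMeas ν w :=
  fun e he => (hw e he).mono_ac (h.restrict e.source)

section Borel

variable [BorelSpace M]

lemma IsMeas.congr (hw : IsMeas μ w) (h : ∀ᵐ x ∂μ, w x = η x) : IsMeas μ η := by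
  intro e he
  refine (hw e he).congr ?_
  filter_upwards [ae_restrict_of_ae h, ae_restrict_mem e.open_source.measurableSet] with x hx hxe
  exact localRep_congr (by rwa [e.left_inv hxe])

lemma IsSmooth.isMeas [SecondCountableTopology M] (hw : IsSmooth w) : IsMeas μ w := fun e he =>
  ((hw e he).continuousOn.comp e.continuousOn e.mapsTo).aestronglyMeasurable
    e.open_source.measurableSet

end Borel

variable [IsManifold (𝓡 n) ∞ M] (g : Metric n M)

lemma normSq_congr (h : ∀ᵐ x ∂μ, w x = η x) : normSq g μ w = normSq g μ η :=
  lintegral_congr_ae (h.mono fun x hx => by simp only [hx])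

lemma l2Inner_congr_left (h : ∀ᵐ x ∂μ, w x = η x) (θ : DiffForm n M k) :
    l2Inner g μ w θ = l2Inner g μ η θ :=
  integral_congr_ae (h.mono fun x hx => by simp only [hx])

lemma l2Inner_eq_zero_of_left (h : ∀ᵐ x ∂μ, w x = 0) (θ : DiffForm n M k) :
    l2Inner g μ w θ = 0 :=
  integral_eq_zero_of_ae (h.mono fun x hx => by simp [hx, formInner_zero_left])

lemma l2Inner_eq_zero_of_right (w : DiffForm n M k) {θ : DiffForm n M k}
    (h : ∀ᵐ x ∂μ, θ x = 0) : l2Inner g μ w θ = 0 :=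
  integral_eq_zero_of_ae (h.mono fun x hx => by simp [hx, formInner_zero_right])

lemma l2Inner_self_nonneg (w : DiffForm n M k) : 0 ≤ l2Inner g μ w w :=
  integral_nonneg fun x => formInner_self_nonneg g x (w x)

lemma isCodiff_of_ae_eq (h : ∀ᵐ x ∂(vol g), w x = η x) {θ : DiffForm n M (k - 1)}
    (hw : IsCodiff g w θ) : IsCodiff g η θ := by
  cases k with
  | zero => exact hw
  | succ k => exact ⟨hw.1, fun ξ hξ => (hw.2 ξ hξ).trans (l2Inner_congr_left g h _)⟩

lemma codiff_congr (h : ∀ᵐ x ∂(vol g), w x = η x) : codiff g w = codiff g η := by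
  -- The defining predicates coincide, so choice returns the same representative: the equality is
  -- literal, not merely almost everywhere.
  have : IsCodiff g w = IsCodiff g η := funext fun θ => propext
    ⟨isCodiff_of_ae_eq g h, isCodiff_of_ae_eq g (h.mono fun _ hx => hx.symm)⟩
  unfold codiff
  rw [this]

lemma MemW12.memL2_extD (hw : MemW12 g w) : MemL2 g (vol g) (extD g w) := by
  rw [extD, dif_pos hw.2.1]
  exact hw.2.1.choose_spec.1

lemma memL2_zero : MemL2 g μ (0 : DiffForm n M k) :=
  ⟨isMeas_zero, by simp [normSq, formInner_zero_left]⟩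

lemma SmoothApprox.tendsto_normSq {u : DiffForm n M k} {s : ℕ → DiffForm n M k}
    (h : SmoothApprox g u s) : Tendsto (fun m => normSq g (vol g) (u - s m)) atTop (𝓝 0) :=
  tendsto_of_tendsto_of_tendsto_of_le_of_le tendsto_const_nhds h.2 (fun _ => zero_le)
    fun _ => le_self_add.trans le_self_add

lemma tendsto_normSq_of_le {C : ℝ≥0∞} (hC : C ≠ ⊤) (hle : μ ≤ C • vol g) {s : ℕ → DiffForm n M k}
    (h : Tendsto (fun m => normSq g (vol g) (s m)) atTop (𝓝 0)) :
    Tendsto (fun m => normSq g μ (s m)) atTop (𝓝 0) := by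
  have h1 := ENNReal.Tendsto.const_mul h (Or.inr hC)
  rw [mul_zero] at h1
  refine tendsto_of_tendsto_of_tendsto_of_le_of_le tendsto_const_nhds h1 (fun _ => zero_le)
    fun m => ?_
  refine (lintegral_mono' hle le_rfl).trans_eq ?_
  rw [lintegral_smul_measure]
  rfl

lemma normSq_lt_top_of_le {C : ℝ≥0∞} (hC : C ≠ ⊤) (hle : μ ≤ C • vol g)
    (h : normSq g (vol g) w < ⊤) : normSq g μ w < ⊤ := by
  refine (lintegral_mono' hle le_rfl).trans_lt ?_
  rw [lintegral_smul_measure]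
  exact ENNReal.mul_lt_top hC.lt_top h

lemma IsCodiff.memL2 {θ : DiffForm n M (k - 1)} (h : IsCodiff g w θ) : MemL2 g (vol g) θ := by
  cases k with
  | zero =>
    have h0 : θ = 0 := h
    rw [h0]
    exact memL2_zero g
  | succ k => exact h.1

lemma MemW12.memL2_codiff (hw : MemW12 g w) : MemL2 g (vol g) (codiff g w) := by
  rw [codiff, dif_pos hw.2.2]
  exact hw.2.2.choose_spec.memL2 g

variable [BorelSpace M]

/-- The defining formula uses the preferred chart at `x`, which may jump with `x`. On each chart of
a countable cover, basis independence replaces it by a formula in that fixed chart. -/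
lemma IsMeas.aemeasurable_formInner [SecondCountableTopology M] (hw : IsMeas μ w)
    (hη : IsMeas μ η) : AEMeasurable (fun x => formInner g x (w x) (η x)) μ := by
  obtain ⟨t, htc, ht⟩ := TopologicalSpace.countable_cover_nhds
    fun x : M => chart_source_mem_nhds (EuclideanSpace ℝ (Fin n)) x
  have : Countable t := htc
  rw [← Measure.restrict_univ (μ := μ), ← ht, biUnion_eq_iUnion, aemeasurable_iUnion_iff]
  rintro ⟨p, -⟩
  set e := chartAt (EuclideanSpace ℝ (Fin n)) p
  have he : e ∈ IsManifold.maximalAtlas (𝓡 n) ∞ M := IsManifold.chart_mem_maximalAtlas p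
  have hgram : ∀ i j, AEMeasurable (fun x => chartGram g e (e x) i j) (μ.restrict e.source) :=
    fun i j => ((continuousOn_chartGram_apply g he i j).comp e.continuousOn
      e.mapsTo).aemeasurable e.open_source.measurableSet
  have hdet : ContinuousOn (fun x => (chartGram g e (e x))) e.source := by
    refine continuousOn_pi.2 fun i => continuousOn_pi.2 fun j => ?_
    exact (continuousOn_chartGram_apply g he i j).comp e.continuousOn e.mapsTo
  have hinv : ∀ i j, AEMeasurable (fun x => (chartGram g e (e x))⁻¹ i j)
      (μ.restrict e.source) := by
    intro i j
    -- Cramer's rule: determinant and adjugate are continuous in the entries, and real inversion is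
    -- measurable even at `0`.
    simp only [Matrix.inv_def, Ring.inverse_eq_inv', Matrix.smul_apply, smul_eq_mul]
    refine AEMeasurable.mul (AEMeasurable.inv ?_) ?_
    · exact ((continuous_id.matrix_det).comp_continuousOn hdet).aemeasurable
        e.open_source.measurableSet
    · exact (((continuous_id.matrix_adjugate).matrix_elem i j).comp_continuousOn
        hdet).aemeasurable e.open_source.measurableSet
  have hcomp : ∀ ξ : DiffForm n M k, IsMeas μ ξ → ∀ v : Fin k → EuclideanSpace ℝ (Fin n),
      AEMeasurable (fun x => localRep e ξ (e x) v) (μ.restrict e.source) := fun ξ hξ v =>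
    ((ContinuousAlternatingMap.apply ℝ (EuclideanSpace ℝ (Fin n)) ℝ
      v).continuous.comp_aestronglyMeasurable (hξ e he)).aemeasurable
  have hsum : AEMeasurable (fun x => (k.factorial : ℝ)⁻¹ * ∑ I : Fin k → Fin n,
      ∑ J : Fin k → Fin n, (∏ a, (chartGram g e (e x))⁻¹ (I a) (J a)) *
          localRep e w (e x) (fun a => EuclideanSpace.single (I a) 1) *
          localRep e η (e x) (fun a => EuclideanSpace.single (J a) 1)) (μ.restrict e.source) := by
    refine AEMeasurable.const_mul (Finset.aemeasurable_fun_sum _ fun I _ =>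
      Finset.aemeasurable_fun_sum _ fun J _ => ?_) _
    exact ((Finset.aemeasurable_fun_prod _ fun a _ => hinv _ _).mul (hcomp w hw _)).mul
      (hcomp η hη _)
  refine hsum.congr ?_
  filter_upwards [ae_restrict_mem e.open_source.measurableSet] with x hx
  rw [← formInner_eq_chart g he w η (e.map_source hx), e.left_inv hx]

/-- The supremum `vol g` dominates each chart measure, whose density is positive, so null sets of
`vol g` are Lebesgue null in coordinates. -/
lemma ae_chart_of_ae_vol {e : OpenPartialHomeomorph M (EuclideanSpace ℝ (Fin n))}
    (he : e ∈ IsManifold.maximalAtlas (𝓡 n) ∞ M) {p : M → Prop} (h : ∀ᵐ x ∂(vol g), p x) :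
    ∀ᵐ y ∂(volume.restrict e.target), p (e.symm y) := by
  have hle : chartVolume g e ≤ vol g :=
    le_iSup₂ (f := fun e (_ : e ∈ IsManifold.maximalAtlas (𝓡 n) ∞ M) => chartVolume g e) e he
  have h1 : ∀ᵐ x ∂(chartVolume g e), p x := h.filter_mono (ae_mono hle)
  have hmeas : AEMeasurable e.symm (volume.restrict e.target) :=
    e.continuousOn_symm.aemeasurable e.open_target.measurableSet
  have h2 := ae_of_ae_map (hmeas.mono_ac (withDensity_absolutelyContinuous _ _)) h1
  have hgram : ContinuousOn (fun y => chartGram g e y) e.target :=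
    continuousOn_pi.2 fun i => continuousOn_pi.2 fun j => continuousOn_chartGram_apply g he i j
  refine h2.filter_mono (withDensity_absolutelyContinuous' ?_ ?_).ae_le
  · exact (ENNReal.continuous_ofReal.comp_continuousOn (Real.continuous_sqrt.comp_continuousOn
      ((continuous_id.matrix_det).comp_continuousOn hgram))).aemeasurable
      e.open_target.measurableSet
  · filter_upwards [ae_restrict_mem e.open_target.measurableSet] with y hy
    simpa using chartGram_det_pos g he hy

section SecondCountable

variable [SecondCountableTopology M]

lemma ae_eq_zero_of_normSq (hw : IsMeas μ w) (h : normSq g μ w = 0) : ∀ᵐ x ∂μ, w x = 0 := by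
  rw [normSq, lintegral_eq_zero_iff' (hw.aemeasurable_formInner g hw).ennreal_ofReal] at h
  filter_upwards [h] with x hx
  exact eq_zero_of_formInner_self g x _
    (le_antisymm (ENNReal.ofReal_eq_zero.1 hx) (formInner_self_nonneg g x _))

lemma ae_eq_zero_of_l2Inner_self (hw : MemL2 g μ w) (h : l2Inner g μ w w = 0) :
    ∀ᵐ x ∂μ, w x = 0 := by
  refine ae_eq_zero_of_normSq g hw.1 ?_
  have hnn : 0 ≤ᵐ[μ] fun x => formInner g x (w x) (w x) :=
    ae_of_all _ fun x => formInner_self_nonneg g x (w x)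
  have hlt := hw.2
  rw [l2Inner, integral_eq_lintegral_of_nonneg_ae hnn
    (hw.1.aemeasurable_formInner g hw.1).aestronglyMeasurable] at h
  -- Finiteness of the norm excludes the value `⊤`, which `toReal` also sends to `0`.
  exact ((ENNReal.toReal_eq_zero_iff _).1 h).resolve_right hlt.ne

/-- Limits in `L²` are unique up to null sets. -/
lemma ae_eq_of_tendsto_normSq {u : DiffForm n M k} {s : ℕ → DiffForm n M k} (hw : IsMeas μ w)
    (hu : IsMeas μ u) (hs : ∀ m, IsMeas μ (s m))
    (hws : Tendsto (fun m => normSq g μ (w - s m)) atTop (𝓝 0))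
    (hus : Tendsto (fun m => normSq g μ (u - s m)) atTop (𝓝 0)) : ∀ᵐ x ∂μ, w x = u x := by
  have hle : ∀ m, normSq g μ (w - u) ≤ 2 * normSq g μ (w - s m) + 2 * normSq g μ (u - s m) := by
    intro m
    have hmw : AEMeasurable (fun x => ENNReal.ofReal
        (formInner g x ((w - s m) x) ((w - s m) x))) μ :=
      ((hw.sub (hs m)).aemeasurable_formInner g (hw.sub (hs m))).ennreal_ofReal
    have h2 : ENNReal.ofReal 2 ≠ ⊤ := ENNReal.ofReal_ne_top
    simp only [normSq, ← ENNReal.ofReal_ofNat 2]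
    rw [← lintegral_const_mul' _ _ h2, ← lintegral_const_mul' _ _ h2,
      ← lintegral_add_left' (hmw.const_mul _)]
    refine lintegral_mono fun x => ?_
    rw [← ENNReal.ofReal_mul (by norm_num), ← ENNReal.ofReal_mul (by norm_num),
      ← ENNReal.ofReal_add (mul_nonneg (by norm_num) (formInner_self_nonneg g x _))
        (mul_nonneg (by norm_num) (formInner_self_nonneg g x _))]
    exact ENNReal.ofReal_le_ofReal (formInner_sub_self_le g x (w x) (u x) (s m x))
  have hlim : Tendsto (fun m => 2 * normSq g μ (w - s m) + 2 * normSq g μ (u - s m)) atTop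
      (𝓝 (2 * 0 + 2 * 0)) :=
    (ENNReal.Tendsto.const_mul hws (Or.inr (by simp))).add
      (ENNReal.Tendsto.const_mul hus (Or.inr (by simp)))
  have h0 : normSq g μ (w - u) = 0 := by
    refine le_antisymm (ge_of_tendsto' hlim hle |>.trans (by simp)) zero_le
  filter_upwards [ae_eq_zero_of_normSq g (hw.sub hu) h0] with x hx
  exact sub_eq_zero.1 hx

end SecondCountable

/-! ### Invariance of weak derivatives and of $W^{1,2}_0$ under almost-everywhere equality. -/

lemma HasWeakGradOn.congr {F : Type*} [NormedAddCommGroup F] [NormedSpace ℝ F]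
    {U : Set (EuclideanSpace ℝ (Fin n))} (hU : IsOpen U) {f f' : EuclideanSpace ℝ (Fin n) → F}
    {D : EuclideanSpace ℝ (Fin n) → EuclideanSpace ℝ (Fin n) →L[ℝ] F}
    (h : HasWeakGradOn U f D) (hf : ∀ᵐ y ∂(volume.restrict U), f y = f' y) :
    HasWeakGradOn U f' D := by
  refine ⟨h.1.congr hf, h.2.1, fun φ hφ hc hsupp v => ?_⟩
  rw [← h.2.2 φ hφ hc hsupp v]
  refine integral_congr_ae ?_
  filter_upwards [(ae_restrict_iff' hU.measurableSet).1 hf] with y hy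
  by_cases hyU : y ∈ U
  · simp only [hy hyU]
  -- Off `U` the values of `f` and `f'` are unrelated, but the derivative of the test function
  -- vanishes there.
  · have : fderiv ℝ φ y = 0 := by
      by_contra hne
      exact hyU (hsupp (support_fderiv_subset ℝ hne))
    simp [this]

lemma isExtD_of_ae_eq (h : ∀ᵐ x ∂(vol g), w x = η x) {θ : DiffForm n M (k + 1)}
    (hw : IsExtD g w θ) : IsExtD g η θ := by
  refine ⟨hw.1, fun e he => ?_⟩
  obtain ⟨D, hD, hae⟩ := hw.2 e he
  exact ⟨D, hD.congr e.open_target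
    ((ae_chart_of_ae_vol g he h).mono fun y hy => localRep_congr hy), hae⟩

lemma extD_congr (h : ∀ᵐ x ∂(vol g), w x = η x) : extD g w = extD g η := by
  have : IsExtD g w = IsExtD g η := funext fun θ => propext
    ⟨isExtD_of_ae_eq g h, isExtD_of_ae_eq g (h.mono fun _ hx => hx.symm)⟩
  unfold extD
  rw [this]

lemma w12NormSq_congr (h : ∀ᵐ x ∂(vol g), w x = η x) : w12NormSq g w = w12NormSq g η := by
  simp only [w12NormSq, extD_congr g h, codiff_congr g h, normSq_congr g h]

lemma mem_W120_of_ae_eq (h : ∀ᵐ x ∂(vol g), w x = η x) (hw : w ∈ W120 g k) : η ∈ W120 g k := by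
  obtain ⟨⟨⟨hm, hfin⟩, ⟨θ, hθ⟩, ξ, hξ⟩, s, hs, hlim⟩ := hw
  refine ⟨⟨⟨hm.congr h, normSq_congr g h ▸ hfin⟩, ⟨θ, isExtD_of_ae_eq g h hθ⟩, ξ,
    isCodiff_of_ae_eq g h hξ⟩, s, hs, hlim.congr fun m => w12NormSq_congr g ?_⟩
  filter_upwards [h] with x hx
  simp only [Pi.sub_apply, hx]

/-! ### The map $\iota_\mu$ and the identification of harmonic forms. -/

variable [SecondCountableTopology M]

/-- The image of a form in `L²(μ)` is the form itself, if `μ` is dominated by the volume. -/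
lemma IsRep.ae_eq {C : ℝ≥0∞} (hC : C ≠ ⊤) (hle : μ ≤ C • vol g) (hac : vol g ≪ μ)
    {u : DiffForm n M k} (hu : MemW12 g u) (h : IsRep g μ u w) : ∀ᵐ x ∂(vol g), u x = w x := by
  obtain ⟨⟨hm, -⟩, s, hs, hlim⟩ := h
  have hμ : μ ≪ vol g := Measure.absolutelyContinuous_of_le_smul hle
  exact hac.ae_le (ae_eq_of_tendsto_normSq g (hu.1.1.mono_ac hμ) hm (fun m => (hs.1 m).isMeas)
    (tendsto_normSq_of_le g hC hle (SmoothApprox.tendsto_normSq g hs)) hlim)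

/-- If `μ` has the null sets of the volume and a bounded density, then the `μ`-harmonic forms are
the harmonic fields. -/
theorem muHarmonicForms_eq_harmonicFields {C : ℝ≥0∞} (hC : C ≠ ⊤) (hle : μ ≤ C • vol g)
    (hac : vol g ≪ μ) (k : ℕ) : muHarmonicForms g μ k = harmonicFields g k := by
  ext w
  constructor
  · rintro ⟨-, u, hu, hrep, hE⟩
    have huw := hrep.ae_eq g hC hle hac hu.1.1
    -- The weak equation is tested with `u` itself, whose image is `w`.
    have h0 : energy g u u = 0 := by
      rw [hE u hu w hrep, neg_zero]
      exact l2Inner_eq_zero_of_left g (ae_of_all _ fun _ => rfl) _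
    have hd := l2Inner_self_nonneg g (μ := vol g) (extD g u)
    have hd' := l2Inner_self_nonneg g (μ := vol g) (codiff g u)
    rw [energy] at h0
    refine ⟨mem_W120_of_ae_eq g huw hu.1, ?_, ?_⟩
    · rw [← extD_congr g huw]
      exact ae_eq_zero_of_l2Inner_self g (MemW12.memL2_extD g hu.1.1) (by linarith)
    · rw [← codiff_congr g huw]
      exact ae_eq_zero_of_l2Inner_self g (MemW12.memL2_codiff g hu.1.1) (by linarith)
  · rintro ⟨hw, hd, hd'⟩
    have hE : ∀ v : DiffForm n M k, energy g w v = 0 := fun v => by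
      rw [energy, l2Inner_eq_zero_of_left g hd, l2Inner_eq_zero_of_left g hd', add_zero]
    refine ⟨memL2_zero g, w, ⟨hw, ?_⟩, ?_, fun v _ v' _ => ?_⟩
    -- Elements of the null space vanish almost everywhere, so orthogonality to them is automatic
    -- and `w` serves as its own preimage under $\iota_\mu$.
    · rintro v ⟨hv, v', hrep, hv'⟩
      have hv0 : ∀ᵐ x ∂(vol g), v x = 0 := by
        filter_upwards [hrep.ae_eq g hC hle hac hv.1,
          hac.ae_le (ae_eq_zero_of_normSq g hrep.1.1 hv')] with x h1 h2
        rw [h1, h2]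
      rw [w12Inner, hE, l2Inner_eq_zero_of_right g w hv0, add_zero]
    · obtain ⟨hmem, s, hs⟩ := hw
      exact ⟨⟨hmem.1.1.mono_ac (Measure.absolutelyContinuous_of_le_smul hle),
        normSq_lt_top_of_le g hC hle hmem.1.2⟩, s, hs,
        tendsto_normSq_of_le g hC hle (SmoothApprox.tendsto_normSq g hs)⟩
    · rw [hE, neg_zero]
      exact (l2Inner_eq_zero_of_left g (ae_of_all _ fun _ => rfl) _).symm

end Measure

end HodgeKF

end

theorem proposition4p2 (n k : ℕ) (M : Type*) [TopologicalSpace M] [T2Space M] [CompactSpace M]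
    [ChartedSpace (EuclideanSpace ℝ (Fin n)) M] [IsManifold (𝓡 n) ∞ M]
    [MeasurableSpace M] [BorelSpace M] (g : HodgeKF.Metric n M)
    (μ : Measure M) [IsFiniteMeasure μ] (ρ : M → ℝ) (hρ : Measurable ρ)
    (hμ : μ = (HodgeKF.vol g).withDensity fun x => ENNReal.ofReal (ρ x))
    (hpos : ∀ᵐ x ∂(HodgeKF.vol g), 0 < ρ x)
    (hbdd : ∃ C : ℝ, ∀ᵐ x ∂(HodgeKF.vol g), ρ x ≤ C) :
    HodgeKF.muHarmonicForms g μ k = HodgeKF.harmonicForms g k ∧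
      HodgeKF.harmonicForms g k = HodgeKF.harmonicFields g k := by
  have : SecondCountableTopology M :=
    ChartedSpace.secondCountable_of_sigmaCompact (EuclideanSpace ℝ (Fin n)) M
  obtain ⟨C, hC⟩ := hbdd
  have hle : μ ≤ ENNReal.ofReal C • HodgeKF.vol g := by
    rw [hμ, ← withDensity_const]
    exact withDensity_mono (hC.mono fun x hx => ENNReal.ofReal_le_ofReal hx)
  have hac : HodgeKF.vol g ≪ μ := by
    rw [hμ]
    exact withDensity_absolutelyContinuous' hρ.ennreal_ofReal.aemeasurable
      (hpos.mono fun x hx => by simpa using hx)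
  -- The case $\mu=V_g$, with constant `1`.
  have hvol : HodgeKF.harmonicForms g k = HodgeKF.harmonicFields g k :=
    HodgeKF.muHarmonicForms_eq_harmonicFields g ENNReal.one_ne_top (by rw [one_smul])
      Measure.AbsolutelyContinuous.rfl k
  exact ⟨(HodgeKF.muHarmonicForms_eq_harmonicFields g ENNReal.ofReal_ne_top hle hac k).trans
    hvol.symm, hvol⟩
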